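/- Rings are associative but need not have an identity element. Let $R$ be a ring such that: (a) $R$ is purely infinite simple: $R\neq 0$, the only two-sided ideals of $R$ are $0$ and $R$, and every nonzero right ideal of $R$ contains an infinite idempotent. Here an idempotent $e\in R$ is called infinite if $e=f+g$ for some idempotents $f,g\in R$ with $fg=gf=0$ and $g\neq 0$, such that $e=xy$ and $f=yx$ for some $x,y\in R$; (b) $R$ is $\sigma$-unital: there is a net $(a_\lambda)_{\lambda\in\Lambda}$ in $R$, indexed by a nonempty countable directed set $\Lambda$, such that for every $x\in R$ there is $\lambda_0\in\Lambda$ with $a_\lambda x=x=xa_\lambda$ for all $\lambda\geq\lambda_0$; (c) $R$ is non-unital: it has no two-sided identity element. For a ring $S$, let $M_\infty(S)$ be the ring of countably infinite matrices over $S$ (rows and columns indexed by $\mathbb{N}$) with only finitely many nonzero entries. Then: 1. $R\cong M_\infty(R)$ as rings; 2. for every nonzero idempotent $q\in R$, $R\cong M_\infty(qRq)$ as rings. -/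

import Mathlib

/-- Two idempotents `p, q` of a (not necessarily unital) ring are equivalent, `p ∼ q`, if
`p = x * y` and `q = y * x` for some elements `x, y`. -/
def IdempotentEquiv {R : Type*} [NonUnitalRing R] (p q : R) : Prop :=
  ∃ x y : R, x * y = p ∧ y * x = q

/-- An idempotent `e` is infinite if `e = f + g` with `f, g` orthogonal idempotents, `e ∼ f`
and `g ≠ 0`. -/
def IsInfiniteIdempotent {R : Type*} [NonUnitalRing R] (e : R) : Prop :=
  IsIdempotentElem e ∧ ∃ f g : R, IsIdempotentElem f ∧ IsIdempotentElem g ∧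
    f * g = 0 ∧ g * f = 0 ∧ e = f + g ∧ IdempotentEquiv e f ∧ g ≠ 0

/-- A right ideal of a (not necessarily unital) ring: an additive subgroup that absorbs
multiplication on the right. -/
def IsRightIdeal {R : Type*} [NonUnitalRing R] (I : AddSubgroup R) : Prop :=
  ∀ a ∈ I, ∀ r : R, a * r ∈ I

/-- A ring is purely infinite simple if it is simple and every nonzero right ideal contains an
infinite idempotent. -/
structure IsPurelyInfiniteSimple (R : Type*) [NonUnitalRing R] : Prop where
  simple : IsSimpleRing R
  exists_infinite : ∀ I : AddSubgroup R, IsRightIdeal I → I ≠ ⊥ →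
    ∃ e ∈ I, IsInfiniteIdempotent e

/-- A net `a` in `R`, indexed by a directed preorder, is an approximate unit if it converges to `1`
in the strict topology of the multiplier ring: for every `x`, eventually
`(a i - 1) * x = x * (a i - 1) = 0`, that is, `a i * x = x` and `x * a i = x`. -/
def IsApproximateUnitNet {R Λ : Type*} [NonUnitalRing R] [Preorder Λ] (a : Λ → R) : Prop :=
  ∀ x : R, ∃ i₀ : Λ, ∀ i : Λ, i₀ ≤ i → a i * x = x ∧ x * a i = x

/-- A ring is `σ`-unital if it has a countable approximate unit. (Every countable directed index
set has a copy in `Type`.) -/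
def IsSigmaUnital (R : Type*) [NonUnitalRing R] : Prop :=
  ∃ (Λ : Type) (_ : Preorder Λ) (a : Λ → R),
    Nonempty Λ ∧ Countable Λ ∧ IsDirectedOrder Λ ∧ IsApproximateUnitNet a

/-- A ring has an identity element. -/
def HasIdentity (R : Type*) [NonUnitalRing R] : Prop :=
  ∃ u : R, ∀ x : R, u * x = x ∧ x * u = x

/-- The additive group of countably infinite matrices over `S` with only finitely many nonzero
entries. -/
def finitaryMatrices (S : Type*) [NonUnitalRing S] : AddSubgroup (Matrix ℕ ℕ S) where
  carrier := {A | {p : ℕ × ℕ | A p.1 p.2 ≠ 0}.Finite}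
  zero_mem' := by simp
  add_mem' {A B} hA hB := (hA.union hB).subset fun p hp => by
    by_contra h
    simp only [Set.mem_union, Set.mem_ofPred_eq, not_or, not_not] at h
    exact hp (by simp [h.1, h.2])
  neg_mem' {A} hA := hA.subset fun p hp h => hp (by simp [h])

/-- `MInfty S` is the ring `M_∞(S)` of countably infinite matrices over `S` with only finitely many
nonzero entries; its operations are entrywise addition and the usual matrix product. -/
def MInfty (S : Type*) [NonUnitalRing S] : Type _ := finitaryMatrices S

namespace MInfty

variable {S : Type*} [NonUnitalRing S]

instance : AddCommGroup (MInfty S) := inferInstanceAs (AddCommGroup (finitaryMatrices S))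

/-- The matrix underlying an element of `M_∞(S)`. -/
def entry (A : MInfty S) : ℕ → ℕ → S := A.1

theorem ext {A B : MInfty S} (h : ∀ i j, A.entry i j = B.entry i j) : A = B :=
  Subtype.ext (funext fun i => funext fun j => h i j)

theorem entry_add (A B : MInfty S) (i j : ℕ) :
    (A + B).entry i j = A.entry i j + B.entry i j := rfl

theorem entry_zero (i j : ℕ) : (0 : MInfty S).entry i j = 0 := rfl

theorem exists_bound (A : MInfty S) :
    ∃ n : ℕ, ∀ i j, n ≤ i ∨ n ≤ j → A.entry i j = 0 := by
  have hA : {p : ℕ × ℕ | A.entry p.1 p.2 ≠ 0}.Finite := A.2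
  obtain ⟨n₁, h₁⟩ := (hA.image Prod.fst).bddAbove
  obtain ⟨n₂, h₂⟩ := (hA.image Prod.snd).bddAbove
  refine ⟨n₁ + n₂ + 1, fun i j hij => ?_⟩
  by_contra h
  have a := h₁ ⟨(i, j), h, rfl⟩
  have b := h₂ ⟨(i, j), h, rfl⟩
  simp only at a b
  omega

theorem finsum_eq (A B : MInfty S) {n : ℕ} (hA : ∀ i j, n ≤ i ∨ n ≤ j → A.entry i j = 0)
    (i k : ℕ) :
    ∑ᶠ j, A.entry i j * B.entry j k = ∑ j ∈ Finset.range n, A.entry i j * B.entry j k := by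
  refine finsum_eq_sum_of_support_subset _ fun j hj => ?_
  by_contra h
  simp only [Finset.coe_range, Set.mem_Iio, not_lt] at h
  exact hj (by simp [hA i j (Or.inr h)])

/-- The matrix product; each of the sums has only finitely many nonzero terms. -/
noncomputable instance : Mul (MInfty S) where
  mul A B := ⟨fun i k => ∑ᶠ j, A.entry i j * B.entry j k, by
    obtain ⟨n, hn⟩ := A.exists_bound
    obtain ⟨m, hm⟩ := B.exists_bound
    refine ((Set.finite_Iio n).prod (Set.finite_Iio m)).subset fun p hp => ?_
    by_contra h
    apply hp
    have h' : n ≤ p.1 ∨ m ≤ p.2 := by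
      simp only [Set.mem_prod, Set.mem_Iio, not_and_or, not_lt] at h
      exact h
    change ∑ᶠ j, A.entry p.1 j * B.entry j p.2 = 0
    rcases h' with h' | h'
    · simp [hn _ _ (Or.inl h')]
    · simp [hm _ _ (Or.inr h')]⟩

theorem entry_mul (A B : MInfty S) (i k : ℕ) :
    (A * B).entry i k = ∑ᶠ j, A.entry i j * B.entry j k := rfl

theorem entry_mul_eq_sum (A B : MInfty S) {n : ℕ}
    (hA : ∀ i j, n ≤ i ∨ n ≤ j → A.entry i j = 0) (i k : ℕ) :
    (A * B).entry i k = ∑ j ∈ Finset.range n, A.entry i j * B.entry j k :=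
  finsum_eq A B hA i k

noncomputable instance : NonUnitalRing (MInfty S) where
  __ := (inferInstance : AddCommGroup (MInfty S))
  __ := (inferInstance : Mul (MInfty S))
  left_distrib A B C := ext fun i k => by
    obtain ⟨n, hn⟩ := A.exists_bound
    simp only [entry_add, entry_mul_eq_sum A _ hn, mul_add, Finset.sum_add_distrib]
  right_distrib A B C := ext fun i k => by
    obtain ⟨n, hn⟩ := A.exists_bound
    obtain ⟨m, hm⟩ := B.exists_bound
    have hA : ∀ i j, n + m ≤ i ∨ n + m ≤ j → A.entry i j = 0 :=
      fun i j h => hn i j (by omega)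
    have hB : ∀ i j, n + m ≤ i ∨ n + m ≤ j → B.entry i j = 0 :=
      fun i j h => hm i j (by omega)
    have hAB : ∀ i j, n + m ≤ i ∨ n + m ≤ j → (A + B).entry i j = 0 :=
      fun i j h => by rw [entry_add, hA i j h, hB i j h, add_zero]
    rw [entry_add, entry_mul_eq_sum _ _ hAB, entry_mul_eq_sum _ _ hA, entry_mul_eq_sum _ _ hB]
    simp only [entry_add, add_mul, Finset.sum_add_distrib]
  zero_mul A := ext fun i k => by simp [entry_mul, entry_zero]
  mul_zero A := ext fun i k => by simp [entry_mul, entry_zero]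
  mul_assoc A B C := ext fun i l => by
    obtain ⟨n, hn⟩ := A.exists_bound
    obtain ⟨m, hm⟩ := B.exists_bound
    have hAB : ∀ i j, n + m ≤ i ∨ n + m ≤ j → (A * B).entry i j = 0 := fun i j h => by
      rw [entry_mul_eq_sum A B hn]
      refine Finset.sum_eq_zero fun t ht => ?_
      rcases h with h | h
      · rw [hn i t (Or.inl (by omega)), zero_mul]
      · rw [hm t j (Or.inr (by omega)), mul_zero]
    have hB : ∀ i j, n + m ≤ i ∨ n + m ≤ j → B.entry i j = 0 :=
      fun i j h => hm i j (by omega)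
    rw [entry_mul_eq_sum _ C hAB, entry_mul_eq_sum A _ hn]
    simp only [entry_mul_eq_sum A B hn, entry_mul_eq_sum B C hB, Finset.sum_mul, Finset.mul_sum,
      mul_assoc]
    exact Finset.sum_comm

end MInfty

/-! ### Infinite idempotents, subequivalence and orthogonality. -/

section PurelyInfinite

variable {R : Type*} [NonUnitalRing R]

/-! Fix a nonzero idempotent `q`. The aim is to write the identity of the multiplier ring as a
strict sum of orthogonal idempotents `X i * Y i`, each equivalent to `q` (`IsMatrixSystem`). Then `r
↦ (Y i * r * X j)` identifies `R` with the finitary matrices over `qRq`, which is the second claim.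

Pure infiniteness makes every idempotent subequivalent to every nonzero one (`exists_subequiv`), and
non-unitality leaves a nonzero idempotent orthogonal to any given element (`exists_orthogonal`).
Together they give idempotent local units (`exists_idempotent_unit`) and allow any idempotent to be
enlarged past a given element by exactly one orthogonal copy of `q` (`exists_enlarge`). Iterating
along a countable approximate unit yields the system.

For the first claim, a system in `R` for `q` induces one in `MInfty R` with the same corner, so both
rings are finitary matrices over `qRq`. -/

theorem mul_mul_eq_of_mul_eq {a b c : R} (h : a * b = c) (z : R) : a * (b * z) = c * z := by
  rw [← mul_assoc, h]

/-- In a simple ring, a nonzero idempotent generates the whole ring as a two-sided ideal. -/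
theorem mem_closure_mul_idempotent_mul (hR : IsSimpleRing R) {g : R} (hg : IsIdempotentElem g)
    (hg0 : g ≠ 0) (x : R) :
    x ∈ AddSubmonoid.closure {z : R | ∃ a b, a * g * b = z} := by
  -- Since `-(a * g * b) = (-a) * g * b`, the additive monoid of sums of such products is already a
  -- two-sided ideal.
  set C := AddSubmonoid.closure {z : R | ∃ a b, a * g * b = z} with hC
  have hneg : ∀ {z}, z ∈ C → -z ∈ C := fun {z} hz => by
    induction hz using AddSubmonoid.closure_induction with
    | mem z h =>
      obtain ⟨a, b, rfl⟩ := h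
      exact AddSubmonoid.subset_closure ⟨-a, b, by simp⟩
    | zero => simp
    | add u v _ _ hu hv => rw [neg_add]; exact add_mem hu hv
  have hleft : ∀ {r z}, z ∈ C → r * z ∈ C := fun {r z} hz => by
    induction hz using AddSubmonoid.closure_induction with
    | mem z h =>
      obtain ⟨a, b, rfl⟩ := h
      exact AddSubmonoid.subset_closure ⟨r * a, b, by simp only [mul_assoc]⟩
    | zero => simp
    | add u v _ _ hu hv => rw [mul_add]; exact add_mem hu hv
  have hright : ∀ {z r}, z ∈ C → z * r ∈ C := fun {z r} hz => by
    induction hz using AddSubmonoid.closure_induction with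
    | mem z h =>
      obtain ⟨a, b, rfl⟩ := h
      exact AddSubmonoid.subset_closure ⟨a, b * r, by simp only [mul_assoc]⟩
    | zero => simp
    | add u v _ _ hu hv => rw [add_mul]; exact add_mem hu hv
  let I : TwoSidedIdeal R := TwoSidedIdeal.mk' C C.zero_mem C.add_mem hneg hleft hright
  have hI : ∀ z, z ∈ I ↔ z ∈ C := fun z => TwoSidedIdeal.mem_mk' ..
  have hgI : g ∈ I := (hI g).2 (AddSubmonoid.subset_closure ⟨g, g, by rw [hg.eq, hg.eq]⟩)
  rcases hR.simple.eq_bot_or_eq_top I with h | h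
  · rw [h] at hgI
    exact absurd hgI hg0
  · exact (hI x).1 (h ▸ trivial)

/-- Below a nonzero idempotent of a purely infinite simple ring there are infinitely many
orthogonal copies of some nonzero idempotent. -/
theorem IsPurelyInfiniteSimple.exists_copies (hR : IsPurelyInfiniteSimple R) {h : R}
    (hh : IsIdempotentElem h) (h0 : h ≠ 0) :
    ∃ (g : R) (s t : ℕ → R), IsIdempotentElem g ∧ g ≠ 0 ∧ (∀ i, h * s i = s i) ∧
      (∀ i, t i * h = t i) ∧ (∀ i, s i * g = s i) ∧
      ∀ i j, t i * s j = if i = j then g else 0 := by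
  obtain ⟨e, heI, he, f, g, hf, hg, hfg, hgf, hefg, ⟨x, y, hxy, hyx⟩, hg0⟩ :=
    hR.exists_infinite (AddMonoidHom.mulLeft h).range
      (by rintro _ ⟨b, rfl⟩ r; exact ⟨b * r, by simp [mul_assoc]⟩)
      (fun hb => h0 <| by
        have : h ∈ (AddMonoidHom.mulLeft h).range := ⟨h, by simpa using hh.eq⟩
        simpa [hb] using this)
  have hhe : h * e = e := by
    obtain ⟨r, rfl⟩ := heI
    simp [← mul_assoc, hh.eq]
  have hef : e * f = f := by rw [hefg, add_mul, hf.eq, hgf, add_zero]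
  have heg : e * g = g := by rw [hefg, add_mul, hg.eq, hfg, zero_add]
  have hge : g * e = g := by rw [hefg, mul_add, hg.eq, hgf, zero_add]
  have hxfy : x * f * y = e := by
    rw [← hyx, ← mul_assoc, hxy, mul_assoc, hxy, he.eq]
  -- `s n = (f * y)^n * g` and `t n = g * (x * f)^n`. Adjacent factors cancel by `x * f * (f * y) =
  -- e`; when the exponents differ, `g * f = 0` or `f * g = 0` kills the product.
  let s : ℕ → R := fun n => (fun z => f * y * z)^[n] g
  let t : ℕ → R := fun n => (fun z => z * (x * f))^[n] g
  have s0 : s 0 = g := rfl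
  have t0 : t 0 = g := rfl
  have s1 : ∀ n, s (n + 1) = f * y * s n := fun n => Function.iterate_succ_apply' ..
  have t1 : ∀ n, t (n + 1) = t n * (x * f) := fun n => Function.iterate_succ_apply' ..
  have hes : ∀ i, e * s i = s i := by
    rintro (_ | i)
    · exact heg
    · rw [s1, ← mul_assoc, ← mul_assoc, hef]
  have hsg : ∀ i, s i * g = s i := by
    intro i
    induction i with
    | zero => exact hg.eq
    | succ i ih => rw [s1, mul_assoc, ih]
  have hhs : ∀ i, h * s i = s i := fun i => by rw [← hes, ← mul_assoc, hhe]
  have hts : ∀ i j, t i * s j = if i = j then g else 0 := by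
    intro i
    induction i with
    | zero =>
      rintro (_ | j)
      · exact hg.eq
      · rw [t0, s1, ← mul_assoc, ← mul_assoc, hgf]; simp
    | succ i ih =>
      rintro (_ | j)
      · rw [t1, s0, mul_assoc, mul_assoc, hfg]; simp
      · have : x * f * (f * y) = e := by
          rw [← mul_assoc, mul_assoc x f f, hf.eq, hxfy]
        rw [t1, s1, mul_assoc, ← mul_assoc (x * f), this, hes, ih]
        simp
  -- Only `h * e = e` is known, so `t i` must be cut down by `h` on the right; this is harmless
  -- because `h * s j = s j`.
  refine ⟨g, s, fun i => t i * h, hg, hg0, hhs, fun i => ?_, hsg, fun i j => ?_⟩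
  · rw [mul_assoc, hh.eq]
  · rw [mul_assoc, hhs, hts]

/-- Every element of a purely infinite simple ring factors through every nonzero idempotent. -/
theorem IsPurelyInfiniteSimple.exists_factorization (hR : IsPurelyInfiniteSimple R) {h : R}
    (hh : IsIdempotentElem h) (h0 : h ≠ 0) (x : R) :
    ∃ s t : R, s * t = x ∧ s * h = s ∧ h * t = t := by
  obtain ⟨g, s, t, hg, hg0, hs, ht, hsg, hts⟩ := hR.exists_copies hh h0
  -- With `x = ∑ a k * g * b k`, distinct copies of `g` keep the terms apart: `u = ∑ a k * t k` and
  -- `v = ∑ s k * b k`. The bound `n` records which copies are still unused.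
  suffices ∃ u v : R, u * v = x ∧ u * h = u ∧ h * v = v ∧
      ∃ n, ∀ k, n ≤ k → u * s k = 0 ∧ t k * v = 0 by
    obtain ⟨u, v, h1, h2, h3, -⟩ := this
    exact ⟨u, v, h1, h2, h3⟩
  have hx := mem_closure_mul_idempotent_mul hR.simple hg hg0 x
  induction hx using AddSubmonoid.closure_induction_left with
  | zero => exact ⟨0, 0, by simp⟩
  | add_left z hz y hy ih =>
    obtain ⟨a, b, rfl⟩ := hz
    obtain ⟨u, v, rfl, hu, hv, n, hn⟩ := ih
    refine ⟨a * t n + u, s n * b + v, ?_, ?_, ?_, n + 1, fun k hk => ⟨?_, ?_⟩⟩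
    · have h1 : a * t n * (s n * b) = a * g * b := by
        rw [← mul_assoc, mul_assoc a, hts, if_pos rfl]
      have h2 : a * t n * v = 0 := by rw [mul_assoc, (hn n le_rfl).2, mul_zero]
      have h3 : u * (s n * b) = 0 := by rw [← mul_assoc, (hn n le_rfl).1, zero_mul]
      rw [add_mul, mul_add, mul_add, h1, h2, h3, add_zero, zero_add]
    · rw [add_mul, mul_assoc, ht, hu]
    · rw [mul_add, ← mul_assoc, hs, hv]
    · rw [add_mul, mul_assoc, hts, if_neg (by omega), (hn k (by omega)).1, mul_zero, add_zero]
    · rw [mul_add, ← mul_assoc, hts, if_neg (by omega), (hn k (by omega)).2, zero_mul, add_zero]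

/-- Every idempotent of a purely infinite simple ring is subequivalent to every nonzero one. -/
theorem IsPurelyInfiniteSimple.exists_subequiv (hR : IsPurelyInfiniteSimple R) {p h : R}
    (hp : IsIdempotentElem p) (hh : IsIdempotentElem h) (h0 : h ≠ 0) :
    ∃ s t : R, s * t = p ∧ p * s = s ∧ t * p = t ∧ s * h = s ∧ h * t = t := by
  obtain ⟨s, t, hst, hs, ht⟩ := hR.exists_factorization hh h0 p
  refine ⟨p * s, t * p, ?_, ?_, ?_, ?_, ?_⟩
  · rw [← mul_assoc, mul_assoc p, hst, hp.eq, hp.eq]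
  · rw [← mul_assoc, hp.eq]
  · rw [mul_assoc, hp.eq]
  · rw [mul_assoc, hs]
  · rw [← mul_assoc, ht]

/-- Any two elements have a common two-sided unit. -/
def HasCommonUnits (R : Type*) [NonUnitalRing R] : Prop :=
  ∀ x y : R, ∃ b : R, (b * x = x ∧ x * b = x) ∧ (b * y = y ∧ y * b = y)

theorem IsSigmaUnital.hasCommonUnits (hσ : IsSigmaUnital R) : HasCommonUnits R := by
  obtain ⟨Λ, _, a, -, -, hdir, ha⟩ := hσ
  intro x y
  obtain ⟨i, hi⟩ := ha x
  obtain ⟨j, hj⟩ := ha y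
  obtain ⟨k, hik, hjk⟩ := exists_ge_ge i j
  exact ⟨a k, hi k hik, hj k hjk⟩

theorem IsSigmaUnital.exists_sequence (hσ : IsSigmaUnital R) :
    ∃ a : ℕ → R, ∀ x : R, ∃ n, a n * x = x ∧ x * a n = x := by
  obtain ⟨Λ, _, a, _, _, hdir, ha⟩ := hσ
  obtain ⟨φ, hφ⟩ := exists_surjective_nat Λ
  refine ⟨a ∘ φ, fun x => ?_⟩
  obtain ⟨i, hi⟩ := ha x
  obtain ⟨n, rfl⟩ := hφ i
  exact ⟨n, hi _ le_rfl⟩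

/-- In a non-unital ring with common units, no element is a left identity. -/
theorem HasCommonUnits.exists_mul_ne (hu : HasCommonUnits R) (hn : ¬ HasIdentity R) (c : R) :
    ∃ r, c * r ≠ r := by
  by_contra! hc
  refine hn ⟨c, fun x => ⟨hc x, ?_⟩⟩
  obtain ⟨b, ⟨-, h1⟩, -, h2⟩ := hu x c
  -- A left identity `c` gives `c * b = b`, while `b` is a unit for `c`; so `b = c`.
  rw [hc] at h2
  rw [← h2, h1]

/-- A nonzero idempotent orthogonal to a given element. -/
theorem IsPurelyInfiniteSimple.exists_orthogonal (hR : IsPurelyInfiniteSimple R)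
    (hu : HasCommonUnits R) (hn : ¬ HasIdentity R) (a : R) :
    ∃ f : R, IsIdempotentElem f ∧ f ≠ 0 ∧ f * a = 0 ∧ a * f = 0 := by
  obtain ⟨b, ⟨hba, hab⟩, -⟩ := hu a a
  obtain ⟨c, ⟨hcb, hbc⟩, -⟩ := hu b b
  obtain ⟨r, hr⟩ := hu.exists_mul_ne hn c
  obtain ⟨f, ⟨z, hz⟩, hf⟩ :=
    hR.exists_infinite (AddMonoidHom.id R - AddMonoidHom.mulLeft c).range
      (by rintro _ ⟨z, rfl⟩ r; exact ⟨z * r, by simp [sub_mul, mul_assoc]⟩)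
      (fun hb => hr <| by
        have : r - c * r ∈ (AddMonoidHom.id R - AddMonoidHom.mulLeft c).range := ⟨r, by simp⟩
        rw [hb, AddSubgroup.mem_bot, sub_eq_zero] at this
        exact this.symm)
  have hz' : z - c * z = f := by simpa using hz
  have hbf : b * f = 0 := by rw [← hz', mul_sub, ← mul_assoc, hbc, sub_self]
  have hf0 : f ≠ 0 := by
    obtain ⟨-, f', g', -, hg', hfg, hgf, h1, -, h2⟩ := hf
    rintro rfl
    apply h2
    have : g' * (f' + g') = 0 := by rw [← h1, mul_zero]
    rwa [mul_add, hgf, hg'.eq, zero_add] at this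
  have hff := hf.1.eq
  -- `f` lies in `(1 - c)R`, so `b * f = 0`, which handles only one side. Passing to `f * (1 - b)`
  -- kills `a` on the other side too.
  refine ⟨f - f * b, ?_, fun h => ?_, ?_, ?_⟩
  · have : f * b * f = 0 := by rw [mul_assoc, hbf, mul_zero]
    have : f * b * (f * b) = 0 := by rw [← mul_assoc, this, zero_mul]
    rw [IsIdempotentElem, mul_sub, sub_mul, sub_mul, this, ‹f * b * f = 0›, ← mul_assoc, hff]
    abel
  · apply hf0
    have : (f - f * b) * f = f := by rw [sub_mul, mul_assoc, hbf, mul_zero, hff, sub_zero]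
    rw [← this, h, zero_mul]
  · rw [sub_mul, mul_assoc, hba, sub_self]
  · have haf : a * f = 0 := by rw [← hab, mul_assoc, hbf, mul_zero]
    rw [mul_sub, ← mul_assoc, haf, zero_mul, sub_zero]

end PurelyInfinite

/-! ### Idempotent local units and exhaustion by copies of `q`. -/

section LocalUnits

variable {R : Type*} [NonUnitalRing R]

/-- If `1 + w` is a left inverse of `1 + v`, then `-(v + w + v * w)` is idempotent, being
`1 - (1 + v) * (1 + w)`. -/
theorem isIdempotentElem_of_quasiInverse {v w : R} (h : v + w + w * v = 0) :
    IsIdempotentElem (-(v + w + v * w)) := by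
  have key : -(v + w + v * w) * -(v + w + v * w) - -(v + w + v * w) =
      (v + w + w * v) + v * (v + w + w * v) + (v + w + w * v) * w
        + v * (v + w + w * v) * w := by
    noncomm_ring
  rw [h] at key
  rw [IsIdempotentElem, ← sub_eq_zero, key]
  simp

/-- Every element of a non-unital purely infinite simple ring with common units has an idempotent
unit. -/
theorem IsPurelyInfiniteSimple.exists_idempotent_unit (hR : IsPurelyInfiniteSimple R)
    (hu : HasCommonUnits R) (hn : ¬ HasIdentity R) (a : R) :
    ∃ e : R, IsIdempotentElem e ∧ e * a = a ∧ a * e = a := by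
  obtain ⟨b, ⟨hba, hab⟩, -⟩ := hu a a
  obtain ⟨f, hf, hf0, hfb, hbf⟩ := hR.exists_orthogonal hu hn b
  obtain ⟨g, x, y, hg, hg0, hfx, hyf, hxg, hyx⟩ := hR.exists_copies hf hf0
  have hcopy : ∀ i, x i * y i * (x i * y i) = x i * y i := fun i => by
    rw [← mul_assoc, mul_assoc (x i), hyx, if_pos rfl, hxg]
  have hcopy0 : ∀ i, x i * y i ≠ 0 := fun i h => hg0 <| by
    have : y i * (x i * y i) * x i = g := by
      rw [← mul_assoc, mul_assoc, hyx, if_pos rfl, hg.eq]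
    rw [← this, h, mul_zero, zero_mul]
  obtain ⟨u, v, huv, hfu, hvf, hup, hpv⟩ := hR.exists_subequiv hf (hcopy 0) (hcopy0 0)
  -- In the unitization put `V = 1 - b - f + v + s` and `W = 1 - b - f + u + t`. The cross terms
  -- vanish, `(1 - b - f)^2 = 1 - f - (b + b - b * b)`, and `u * v`, `t * s` supply exactly what is
  -- missing, so `W * V = 1`. As `a * V = 0 = W * a`, the idempotent `1 - V * W` is a unit for `a`.
  obtain ⟨t, s, hts, ht, hs⟩ := hR.exists_factorization (hcopy 1) (hcopy0 1) (b + b - b * b)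
  have hfv : f * v = v := by rw [← hpv, ← mul_assoc, ← mul_assoc, hfx]
  have huf : u * f = u := by rw [← hup, mul_assoc, mul_assoc, hyf]
  have hfs : f * s = s := by rw [← hs, ← mul_assoc, ← mul_assoc, hfx]
  have htf : t * f = t := by rw [← ht, mul_assoc, mul_assoc, hyf]
  have hus : u * s = 0 := by
    rw [← hup, ← hs, mul_assoc, mul_assoc, mul_assoc, mul_mul_eq_of_mul_eq (hyx 0 1)]
    simp
  have htv : t * v = 0 := by
    rw [← ht, ← hpv, mul_assoc, mul_assoc, mul_assoc, mul_mul_eq_of_mul_eq (hyx 1 0)]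
    simp
  have hbv : b * v = 0 := by rw [← hfv, ← mul_assoc, hbf, zero_mul]
  have hbs : b * s = 0 := by rw [← hfs, ← mul_assoc, hbf, zero_mul]
  have hub : u * b = 0 := by rw [← huf, mul_assoc, hfb, mul_zero]
  have htb : t * b = 0 := by rw [← htf, mul_assoc, hfb, mul_zero]
  have haV : a * (v + s - b - f) = -a := by
    rw [← hab]
    simp only [mul_sub, mul_add, mul_assoc, hbv, hbs, hbf, mul_zero]
    rw [← mul_assoc, hab, hab]
    abel
  have hWa : (u + t - b - f) * a = -a := by
    rw [← hba]
    simp only [sub_mul, add_mul, ← mul_assoc, hub, htb, hfb, zero_mul]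
    rw [mul_assoc, hba, hba]
    abel
  refine ⟨_, isIdempotentElem_of_quasiInverse (v := v + s - b - f) (w := u + t - b - f) ?_,
    ?_, ?_⟩
  · simp only [mul_sub, mul_add, sub_mul, add_mul, huv, hus, htv, hts, hub, htb, huf, htf, hbv,
      hbs, hbf, hfv, hfs, hfb, hf.eq]
    abel
  · rw [neg_mul, add_mul, add_mul, mul_assoc _ _ a, hWa, mul_neg]
    abel
  · rw [mul_neg, mul_add, mul_add, ← mul_assoc, haV, neg_mul]
    abel

/-- An idempotent `f` can be enlarged by an orthogonal copy of a given nonzero idempotent `q` to a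
unit for a given element. -/
theorem IsPurelyInfiniteSimple.exists_enlarge (hR : IsPurelyInfiniteSimple R)
    (hu : HasCommonUnits R) (hn : ¬ HasIdentity R) {q : R} (hq : IsIdempotentElem q) (hq0 : q ≠ 0)
    {f : R} (hf : IsIdempotentElem f) (r : R) :
    ∃ x y : R, y * x = q ∧ x * q = x ∧ q * y = y ∧ f * x = 0 ∧ y * f = 0 ∧
      (f + x * y) * r = r ∧ r * (f + x * y) = r := by
  obtain ⟨c, ⟨hcf, hfc⟩, hcr, hrc⟩ := hu f r
  obtain ⟨e, he, hec, hce⟩ := hR.exists_idempotent_unit hu hn c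
  have hef : e * f = f := by rw [← hcf, ← mul_assoc, hec]
  have hfe : f * e = f := by rw [← hfc, mul_assoc, hce]
  have her : e * r = r := by rw [← hcr, ← mul_assoc, hec]
  have hre : r * e = r := by rw [← hrc, mul_assoc, hce]
  obtain ⟨k, hk, hk0, hke, hek⟩ := hR.exists_orthogonal hu hn e
  have hp : IsIdempotentElem (e - f) := by
    rw [IsIdempotentElem, mul_sub, sub_mul, sub_mul, he.eq, hef, hfe, hf.eq, sub_self, sub_zero]
  obtain ⟨s, t, hst, hs, ht, hsq, hqt⟩ := hR.exists_subequiv hp hq hq0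
  have hes : e * s = s := by
    rw [← hs, ← mul_assoc, mul_sub, he.eq, hef]
  have hte : t * e = t := by
    rw [← ht, mul_assoc, sub_mul, he.eq, hfe]
  have hfs : f * s = 0 := by
    rw [← hs, ← mul_assoc, mul_sub, hfe, hf.eq, sub_self, zero_mul]
  have htf : t * f = 0 := by
    rw [← ht, mul_assoc, sub_mul, hef, hf.eq, sub_self, mul_zero]
  have hsts : s * (t * s) = s := by rw [← mul_assoc, hst, hs]
  have htst : t * s * t = t := by rw [mul_assoc, hst, ht]
  have hd : IsIdempotentElem (q - t * s) := by
    have h1 : q * (t * s) = t * s := by rw [← mul_assoc, hqt]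
    have h2 : t * s * q = t * s := by rw [mul_assoc, hsq]
    have h3 : t * s * (t * s) = t * s := by rw [← mul_assoc, htst]
    rw [IsIdempotentElem, mul_sub, sub_mul, sub_mul, hq.eq, h1, h2, h3, sub_self, sub_zero]
  obtain ⟨s', t', hst', hs', ht', hsk, hkt⟩ := hR.exists_subequiv hd hk hk0
  -- `e - f` is equivalent to `t * s`, a part of `q`. The remainder `q - t * s` is copied below `k`,
  -- orthogonally to `e`, so the two pieces assemble to a full copy of `q` and `f + x * y = e + t' *
  -- s'` still dominates `e`.
  have hqs : q * s' = s' := by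
    rw [← hs', ← mul_assoc, mul_sub, hq.eq, ← mul_assoc, hqt]
  have htq : t' * q = t' := by
    rw [← ht', mul_assoc, sub_mul, hq.eq, mul_assoc, hsq]
  have het : e * t' = 0 := by rw [← hkt, ← mul_assoc, hek, zero_mul]
  have hse : s' * e = 0 := by rw [← hsk, mul_assoc, hke, mul_zero]
  have hss : s * s' = 0 := by
    rw [← hs', ← mul_assoc, mul_sub, hsq, hsts, sub_self, zero_mul]
  have htt : t' * t = 0 := by
    rw [← ht', mul_assoc, sub_mul, hqt, htst, sub_self, mul_zero]
  have htt' : t * t' = 0 := by rw [← hte, mul_assoc, het, mul_zero]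
  have hss' : s' * s = 0 := by rw [← hes, ← mul_assoc, hse, zero_mul]
  have hsum : f + (s + t') * (t + s') = e + t' * s' := by
    rw [add_mul, mul_add, mul_add, hst, hss, htt]
    abel
  refine ⟨s + t', t + s', ?_, ?_, ?_, ?_, ?_, ?_, ?_⟩
  · rw [add_mul, mul_add, mul_add, hst', htt', hss']
    abel
  · rw [add_mul, hsq, htq]
  · rw [mul_add, hqt, hqs]
  · rw [mul_add, hfs, ← hfe, mul_assoc, het, mul_zero, add_zero]
  · rw [add_mul, htf, ← hef, ← mul_assoc, hse, zero_mul, add_zero]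
  · rw [hsum, add_mul, her, ← her, mul_assoc t', ← mul_assoc s', hse, zero_mul, mul_zero,
      add_zero]
  · rw [hsum, mul_add, hre, ← hre, mul_assoc r, ← mul_assoc e, het, zero_mul, mul_zero,
      add_zero]

/-- Elements `X i`, `Y i` such that the `X i * Y i` are orthogonal idempotents equivalent to `q`
whose finite sums form a local unit. -/
structure IsMatrixSystem (q : R) (X Y : ℕ → R) : Prop where
  right : ∀ i, X i * q = X i
  left : ∀ i, q * Y i = Y i
  mul : ∀ i j, Y i * X j = if i = j then q else 0
  exists_unit : ∀ r, ∃ s : Finset ℕ, (∑ i ∈ s, X i * Y i) * r = r ∧ r * (∑ i ∈ s, X i * Y i) = r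

/-- Partial sums `F n` grow by one copy of `q` at a time, the `n`-th chosen so that `F (n + 1)` is a
unit for `a n`, hence for every element having `a n` as a unit. -/
theorem IsPurelyInfiniteSimple.exists_isMatrixSystem (hR : IsPurelyInfiniteSimple R)
    (hσ : IsSigmaUnital R) (hn : ¬ HasIdentity R) {q : R} (hq : IsIdempotentElem q)
    (hq0 : q ≠ 0) : ∃ X Y : ℕ → R, IsMatrixSystem q X Y := by
  obtain ⟨a, ha⟩ := hσ.exists_sequence
  choose x y hyx hxq hqy hfx hyf hl hr using
    fun (f : {f : R // IsIdempotentElem f}) (r : R) =>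
      hR.exists_enlarge hσ.hasCommonUnits hn hq hq0 f.2 r
  have hidem : ∀ f r, IsIdempotentElem (f.1 + x f r * y f r) := fun f r => by
    have h1 : f.1 * (x f r * y f r) = 0 := by rw [← mul_assoc, hfx, zero_mul]
    have h2 : x f r * y f r * f.1 = 0 := by rw [mul_assoc, hyf, mul_zero]
    have h3 : x f r * y f r * (x f r * y f r) = x f r * y f r := by
      rw [← mul_assoc, mul_assoc (x f r), hyx, hxq]
    rw [IsIdempotentElem, mul_add, add_mul, add_mul, f.2.eq, h1, h2, h3]
    abel
  let F : ℕ → {f : R // IsIdempotentElem f} :=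
    fun n => Nat.rec ⟨0, .zero⟩ (fun n f => ⟨_, hidem f (a n)⟩) n
  let X : ℕ → R := fun n => x (F n) (a n)
  let Y : ℕ → R := fun n => y (F n) (a n)
  have hF : ∀ n, (F (n + 1)).1 = (F n).1 + X n * Y n := fun n => rfl
  have hsum : ∀ n, ∑ i ∈ Finset.range n, X i * Y i = (F n).1 := by
    intro n
    induction n with
    | zero => rfl
    | succ n ih => rw [Finset.sum_range_succ, ih, hF]
  have hFX : ∀ i j, i < j → (F j).1 * X i = X i := by
    intro i j hij
    induction j, hij using Nat.le_induction with
    | base => rw [hF, add_mul, hfx, mul_assoc, hyx, hxq, zero_add]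
    | succ j _ ih =>
      have : Y j * X i = 0 := by rw [← ih, ← mul_assoc, hyf, zero_mul]
      rw [hF, add_mul, ih, mul_assoc, this, mul_zero, add_zero]
  have hYF : ∀ i j, i < j → Y i * (F j).1 = Y i := by
    intro i j hij
    induction j, hij using Nat.le_induction with
    | base => rw [hF, mul_add, hyf, ← mul_assoc, hyx, hqy, zero_add]
    | succ j _ ih =>
      have : Y i * X j = 0 := by rw [← ih, mul_assoc, hfx, mul_zero]
      rw [hF, mul_add, ih, ← mul_assoc, this, zero_mul, add_zero]
  refine ⟨X, Y, fun i => hxq _ _, fun i => hqy _ _, fun i j => ?_, fun r => ?_⟩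
  · rcases lt_trichotomy i j with h | rfl | h
    · rw [if_neg h.ne, ← hYF i j h, mul_assoc, hfx, mul_zero]
    · rw [if_pos rfl]; exact hyx _ _
    · rw [if_neg h.ne', ← hFX j i h, ← mul_assoc, hyf, zero_mul]
  · obtain ⟨n, h1, h2⟩ := ha r
    refine ⟨Finset.range (n + 1), ?_, ?_⟩
    · rw [hsum, ← h1, ← mul_assoc]
      congr 1
      exact hl _ _
    · rw [hsum, ← h2, mul_assoc]
      congr 1
      exact hr _ _

end LocalUnits

/-! ### Single-entry matrices. -/

namespace MInfty

variable {S : Type*} [NonUnitalRing S]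

/-- The matrix with a single possibly nonzero entry `a` at position `(i, j)`. -/
def single (i j : ℕ) (a : S) : MInfty S :=
  ⟨fun k l => if k = i ∧ l = j then a else 0, (Set.finite_singleton (i, j)).subset fun p hp => by
    by_contra h
    exact hp (if_neg fun h' => h (Prod.ext h'.1 h'.2))⟩

theorem entry_single (i j : ℕ) (a : S) (k l : ℕ) :
    (single i j a).entry k l = if k = i ∧ l = j then a else 0 := rfl

theorem entry_sum {ι : Type*} (s : Finset ι) (A : ι → MInfty S) (i j : ℕ) :
    (∑ k ∈ s, A k).entry i j = ∑ k ∈ s, (A k).entry i j :=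
  map_sum (⟨⟨fun A => A.entry i j, rfl⟩, fun _ _ => rfl⟩ : MInfty S →+ S) A s

theorem entry_single_mul (i j : ℕ) (a : S) (A : MInfty S) (k l : ℕ) :
    (single i j a * A).entry k l = if k = i then a * A.entry j l else 0 := by
  rw [entry_mul, finsum_eq_single _ j fun m hm => by rw [entry_single, if_neg (by tauto), zero_mul],
    entry_single]
  split_ifs <;> simp_all

theorem entry_mul_single (A : MInfty S) (i j : ℕ) (a : S) (k l : ℕ) :
    (A * single i j a).entry k l = if l = j then A.entry k i * a else 0 := by
  rw [entry_mul, finsum_eq_single _ i fun m hm => by rw [entry_single, if_neg (by tauto), mul_zero],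
    entry_single]
  split_ifs <;> simp_all

theorem single_mul_single (i j k l : ℕ) (a b : S) :
    single i j a * single k l b = if j = k then single i l (a * b) else 0 := by
  refine ext fun m n => ?_
  rw [entry_single_mul, entry_single]
  split_ifs <;> simp_all [entry_single, entry_zero]

/-- The embedding of `S` in `MInfty S` at a diagonal position. -/
def singleHom (i : ℕ) : S →ₙ+* MInfty S where
  toFun := single i i
  map_zero' := ext fun k l => by simp [entry_single, entry_zero]
  map_add' a b := ext fun k l => by
    rw [entry_add]
    simp only [entry_single]
    split_ifs <;> simp
  map_mul' a b := by rw [single_mul_single, if_pos rfl]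

theorem singleHom_injective (i : ℕ) : Function.Injective (singleHom (S := S) i) := fun a b h => by
  have h' : (single i i a).entry i i = (single i i b).entry i i := congrArg (fun A => A.entry i i) h
  simpa [entry_single] using h'

end MInfty

/-! ### From matrix systems to ring isomorphisms. -/

namespace IsMatrixSystem

variable {R : Type*} [NonUnitalRing R] {q : R} {X Y : ℕ → R}

theorem sum_mul (h : IsMatrixSystem q X Y) (s : Finset ℕ) (j : ℕ) :
    (∑ i ∈ s, X i * Y i) * X j = if j ∈ s then X j else 0 := by
  simp only [Finset.sum_mul, mul_assoc, h.mul, mul_ite, h.right, mul_zero, Finset.sum_ite_eq']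

theorem mul_sum (h : IsMatrixSystem q X Y) (s : Finset ℕ) (j : ℕ) :
    Y j * (∑ i ∈ s, X i * Y i) = if j ∈ s then Y j else 0 := by
  simp only [Finset.mul_sum, ← mul_assoc, h.mul, ite_mul, h.left, zero_mul, Finset.sum_ite_eq]

theorem unit_mono (h : IsMatrixSystem q X Y) {s s' : Finset ℕ} (hs : s ⊆ s') {r : R}
    (hr : (∑ i ∈ s, X i * Y i) * r = r ∧ r * (∑ i ∈ s, X i * Y i) = r) :
    (∑ i ∈ s', X i * Y i) * r = r ∧ r * (∑ i ∈ s', X i * Y i) = r := by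
  constructor
  · have : (∑ i ∈ s', X i * Y i) * (∑ i ∈ s, X i * Y i) = ∑ i ∈ s, X i * Y i := by
      rw [Finset.mul_sum]
      refine Finset.sum_congr rfl fun j hj => ?_
      rw [← mul_assoc, h.sum_mul, if_pos (hs hj)]
    rw [← hr.1, ← mul_assoc, this]
  · have : (∑ i ∈ s, X i * Y i) * (∑ i ∈ s', X i * Y i) = ∑ i ∈ s, X i * Y i := by
      rw [Finset.sum_mul]
      refine Finset.sum_congr rfl fun j hj => ?_
      rw [mul_assoc, h.mul_sum, if_pos (hs hj)]
    rw [← hr.2, mul_assoc, this]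

theorem exists_range (h : IsMatrixSystem q X Y) (r : R) :
    ∃ n, (∑ i ∈ Finset.range n, X i * Y i) * r = r ∧
      r * (∑ i ∈ Finset.range n, X i * Y i) = r := by
  obtain ⟨s, hs⟩ := h.exists_unit r
  obtain ⟨n, hn⟩ := s.exists_nat_subset_range
  exact ⟨n, h.unit_mono hn hs⟩

theorem exists_common_unit (h : IsMatrixSystem q X Y) {ι : Type*} (t : Finset ι) (r : ι → R) :
    ∃ s : Finset ℕ, ∀ k ∈ t, (∑ i ∈ s, X i * Y i) * r k = r k ∧
      r k * (∑ i ∈ s, X i * Y i) = r k := by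
  choose s hs using fun k => h.exists_unit (r k)
  exact ⟨t.biUnion s, fun k hk => h.unit_mono (Finset.subset_biUnion_of_mem s hk) (hs k)⟩

/-- A ring with a matrix system for `q` is the ring of finitary matrices over any ring isomorphic to
the corner at `q`. -/
theorem nonempty_ringEquiv (h : IsMatrixSystem q X Y) {S : Type*} [NonUnitalRing S]
    (ι : S →ₙ+* R) (hι : Function.Injective ι) (hleft : ∀ a, q * ι a = ι a)
    (hright : ∀ a, ι a * q = ι a) (hrange : ∀ r, q * r = r → r * q = r → ∃ a, ι a = r) :
    Nonempty (R ≃+* MInfty S) := by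
  have hex : ∀ r i j, ∃ a, ι a = Y i * r * X j := fun r i j =>
    hrange _ (by rw [← mul_assoc, ← mul_assoc, h.left]) (by rw [mul_assoc, h.right])
  choose κ hκ using hex
  have hzero : ∀ (r : R) (n : ℕ), (∑ i ∈ Finset.range n, X i * Y i) * r = r ∧
      r * (∑ i ∈ Finset.range n, X i * Y i) = r → ∀ i j, n ≤ i ∨ n ≤ j → κ r i j = 0 := by
    intro r n hr i j hij
    apply hι
    rw [hκ, map_zero]
    rcases hij with hi | hj
    · rw [← hr.1, ← mul_assoc, h.mul_sum, if_neg (by simpa using hi), zero_mul, zero_mul]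
    · rw [← hr.2, mul_assoc, mul_assoc, h.sum_mul, if_neg (by simpa using hj), mul_zero, mul_zero]
  have hexF : ∀ r, ∃ A : MInfty S, ∀ i j, A.entry i j = κ r i j := fun r => by
    obtain ⟨n, hn⟩ := h.exists_range r
    refine ⟨⟨κ r, ((Set.finite_Iio n).prod (Set.finite_Iio n)).subset fun p hp => ?_⟩,
      fun i j => rfl⟩
    by_contra hcon
    simp only [Set.mem_prod, Set.mem_Iio, not_and_or, not_lt] at hcon
    exact hp (hzero r n hn _ _ hcon)
  choose F hF using hexF
  let φ : R →ₙ+* MInfty S :=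
    { toFun := F
      map_zero' := MInfty.ext fun i j => hι <| by
        rw [hF, hκ, MInfty.entry_zero, mul_zero, zero_mul, map_zero]
      map_add' := fun r r' => MInfty.ext fun i j => hι <| by
        rw [MInfty.entry_add, map_add, hF, hF, hF, hκ, hκ, hκ, mul_add, add_mul]
      map_mul' := fun r r' => MInfty.ext fun i j => hι <| by
        obtain ⟨n, hn⟩ := h.exists_range r
        rw [MInfty.entry_mul_eq_sum _ _ (n := n) (by simpa only [hF] using hzero r n hn), map_sum]
        simp only [map_mul, hF, hκ]
        -- Inserting the local unit `∑ X j * Y j` between `r` and `r'` turns the product into the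
        -- matrix product.
        conv_lhs => rw [← hn.2]
        simp only [Finset.mul_sum, Finset.sum_mul, mul_assoc] }
  have hφ : ∀ r i j, ι ((φ r).entry i j) = Y i * r * X j := fun r i j => by
    rw [← hκ, ← hF]; rfl
  refine ⟨RingEquiv.ofBijective φ ⟨?_, fun A => ?_⟩⟩
  · rw [injective_iff_map_eq_zero]
    intro r hr
    have h0 : ∀ i j, Y i * r * X j = 0 := fun i j => by
      rw [← hφ, hr, MInfty.entry_zero, map_zero]
    obtain ⟨n, hn⟩ := h.exists_range r
    rw [← hn.1, ← hn.2, Finset.sum_mul]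
    refine Finset.sum_eq_zero fun i _ => ?_
    rw [Finset.mul_sum, Finset.mul_sum]
    refine Finset.sum_eq_zero fun j _ => ?_
    have := h0 i j
    calc X i * Y i * (r * (X j * Y j)) = X i * (Y i * r * X j) * Y j := by
          simp only [mul_assoc]
      _ = 0 := by rw [this, mul_zero, zero_mul]
  · obtain ⟨n, hn⟩ := A.exists_bound
    refine ⟨∑ i ∈ Finset.range n, ∑ j ∈ Finset.range n, X i * ι (A.entry i j) * Y j,
      MInfty.ext fun k l => hι ?_⟩
    have hterm : ∀ i j, Y k * (X i * ι (A.entry i j) * Y j) * X l =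
        if k = i then (if j = l then ι (A.entry i j) else 0) else 0 := fun i j => by
      have : Y k * (X i * ι (A.entry i j) * Y j) * X l =
        Y k * X i * ι (A.entry i j) * (Y j * X l) := by simp only [mul_assoc]
      rw [this, h.mul, h.mul]
      split_ifs <;> simp [hleft, hright]
    rw [hφ]
    simp only [Finset.mul_sum, Finset.sum_mul, hterm]
    rw [Finset.sum_comm]
    simp only [Finset.sum_ite_eq, Finset.mem_range]
    split_ifs with hk
    · rw [Finset.sum_ite_eq']
      split_ifs with hl
      · rfl
      · rw [hn k l (Or.inr (not_lt.1 (by simpa using hl))), map_zero]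
    · rw [hn k l (Or.inl (not_lt.1 hk)), map_zero, Finset.sum_const_zero]

/-- A matrix system of `R` induces one of `MInfty R` for the same corner. -/
theorem mInfty (h : IsMatrixSystem q X Y) :
    IsMatrixSystem (MInfty.single 0 0 q)
      (fun m => MInfty.single m.unpair.1 0 (X m.unpair.2))
      (fun m => MInfty.single 0 m.unpair.1 (Y m.unpair.2)) where
  right i := by rw [MInfty.single_mul_single, if_pos rfl, h.right]
  left i := by rw [MInfty.single_mul_single, if_pos rfl, h.left]
  mul i j := by
    rw [MInfty.single_mul_single, h.mul]
    by_cases hij : i = j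
    · simp [hij]
    · rw [if_neg hij]
      split_ifs with h1 h2
      · exact absurd (by rw [← Nat.pair_unpair i, h1, h2, Nat.pair_unpair]) hij
      · exact MInfty.ext fun k l => by simp [MInfty.entry_single, MInfty.entry_zero]
      · rfl
  exists_unit A := by
    obtain ⟨n, hn⟩ := A.exists_bound
    obtain ⟨s, hs⟩ := h.exists_common_unit (Finset.range n ×ˢ Finset.range n)
      fun p => A.entry p.1 p.2
    -- Summed over these indices, the system gives the diagonal matrix with the common unit `∑ i ∈
    -- s, X i * Y i` of all entries in its first `n` places.
    refine ⟨(Finset.range n ×ˢ s).map Nat.pairEquiv.toEmbedding, ?_, ?_⟩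
    all_goals
      refine MInfty.ext fun k l => ?_
      simp only [Finset.sum_map, Finset.sum_mul, Finset.mul_sum, MInfty.entry_sum,
        Equiv.coe_toEmbedding, Nat.pairEquiv_apply, Function.uncurry, Nat.unpair_pair,
        MInfty.single_mul_single, if_true, MInfty.entry_single_mul, MInfty.entry_mul_single,
        Finset.sum_product_right, Finset.sum_ite_eq, Finset.mem_range]
      by_cases hkl : k < n ∧ l < n
      · have := hs (k, l) (by simpa using hkl)
        simp only [Finset.sum_mul, Finset.mul_sum] at this
        simp [hkl, this]
      · rw [hn k l (by omega)]
        simp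

end IsMatrixSystem

theorem theorem2p5 {R : Type*} [NonUnitalRing R] (hσ : IsSigmaUnital R)
    (hnonunital : ¬ HasIdentity R) (hpis : IsPurelyInfiniteSimple R) :
    Nonempty (R ≃+* MInfty R) ∧
      ∀ (q : R) (hq : IsIdempotentElem q), q ≠ 0 → Nonempty (R ≃+* MInfty hq.Corner) := by
  have hcorner : ∀ (q : R) (hq : IsIdempotentElem q) (X Y : ℕ → R), IsMatrixSystem q X Y →
      Nonempty (R ≃+* MInfty hq.Corner) := fun q hq X Y h =>
    h.nonempty_ringEquiv (NonUnitalSubringClass.subtype (NonUnitalRing.corner q))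
      Subtype.val_injective
      (fun a => ((Subsemigroup.mem_corner_iff hq).1 a.2).1)
      (fun a => ((Subsemigroup.mem_corner_iff hq).1 a.2).2)
      (fun r h1 h2 => ⟨⟨r, (Subsemigroup.mem_corner_iff hq).2 ⟨h1, h2⟩⟩, rfl⟩)
  refine ⟨?_, fun q hq hq0 => ?_⟩
  -- Orthogonality to `0` is vacuous; this only produces a nonzero idempotent.
  · obtain ⟨q, hq, hq0, -⟩ := hpis.exists_orthogonal hσ.hasCommonUnits hnonunital 0
    obtain ⟨X, Y, h⟩ := hpis.exists_isMatrixSystem hσ hnonunital hq hq0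
    obtain ⟨φ⟩ := hcorner q hq X Y h
    obtain ⟨ψ⟩ := h.mInfty.nonempty_ringEquiv
      ((MInfty.singleHom 0).comp (NonUnitalSubringClass.subtype (NonUnitalRing.corner q)))
      ((MInfty.singleHom_injective 0).comp Subtype.val_injective)
      (fun a => by
        change MInfty.single 0 0 q * MInfty.single 0 0 a.1 = MInfty.single 0 0 a.1
        rw [MInfty.single_mul_single, if_pos rfl, ((Subsemigroup.mem_corner_iff hq).1 a.2).1])
      (fun a => by
        change MInfty.single 0 0 a.1 * MInfty.single 0 0 q = MInfty.single 0 0 a.1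
        rw [MInfty.single_mul_single, if_pos rfl, ((Subsemigroup.mem_corner_iff hq).1 a.2).2])
      -- A matrix fixed on both sides by `MInfty.single 0 0 q` is supported at `(0, 0)` with entry
      -- in `qRq`, so the corner is again `qRq`.
      (fun A h1 h2 => by
        have hl := fun k l => congrArg (fun B => MInfty.entry B k l) h1
        have hr := fun k l => congrArg (fun B => MInfty.entry B k l) h2
        simp only [MInfty.entry_single_mul] at hl
        simp only [MInfty.entry_mul_single] at hr
        refine ⟨⟨A.entry 0 0, (Subsemigroup.mem_corner_iff hq).2
          ⟨by simpa using hl 0 0, by simpa using hr 0 0⟩⟩, MInfty.ext fun k l => ?_⟩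
        change (MInfty.single 0 0 (A.entry 0 0)).entry k l = A.entry k l
        rw [MInfty.entry_single]
        split_ifs with hkl
        · rw [hkl.1, hkl.2]
        · by_cases hk : k = 0
          · rw [← hr, if_neg fun hl => hkl ⟨hk, hl⟩]
          · rw [← hl, if_neg hk])
    exact ⟨φ.trans ψ.symm⟩
  · obtain ⟨X, Y, h⟩ := hpis.exists_isMatrixSystem hσ hnonunital hq hq0
    exact hcorner q hq X Y h
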